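/- Let $K$ be a field and let $G$ be a finite simple graph with vertex set $V$ and edge set $E$. For $C\subseteq V$ let $\delta_C\in\{0,1\}^{E}$ be the vector whose entry at an edge $e$ is $1$ if $|C\cap e|=1$ and $0$ otherwise. Let $A_G$ be the integer matrix whose columns are the distinct vectors among the $\delta_C$ ($C\subseteq V$), each extended by one further entry equal to $1$. The cut ideal $I_G$ is the toric ideal of $A_G$ over $K$, that is, the kernel of the $K$-algebra homomorphism that sends the variable $x_j$ indexed by the $j$-th column $a_j$ of $A_G$ to the Laurent monomial $t^{a_j}$. Contracting an edge of a simple graph means merging its two end vertices, removing the edge and identifying any parallel edges that arise. Suppose that the complete bipartite graph $K_{2,3}$ is obtained (up to isomorphism) from $G$ by a finite, possibly empty, sequence of edge contractions. Then $I_G$ has no lexicographic quadratic Gröbner basis: for every ordering of the variables, $I_G$ has no Gröbner basis consisting of quadratic forms (homogeneous polynomials of degree $2$) with respect to the corresponding lexicographic order; in particular it has none consisting of quadratic binomials. -/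

import Mathlib

noncomputable section

/-- The toric ideal of an integer matrix `A`: the kernel of the `K`-algebra homomorphism from
`K[x_j : j a column of A]` to the Laurent polynomial ring `K[t_i^±1 : i a row of A]` (the monoid
algebra of `ℤ^d`) that sends `x_j` to the Laurent monomial whose exponent vector is column `j`. -/
def toricIdeal (K : Type*) [Field K] {d n : Type*} (A : Matrix d n ℤ) :
    Ideal (MvPolynomial n K) :=
  RingHom.ker (MvPolynomial.aeval
    (fun j : n => (AddMonoidAlgebra.single (fun i : d => A i j) 1 : AddMonoidAlgebra K (d → ℤ))))

open Classical in
/-- The cut vector `δ_C` of a vertex set `C`: its entry at an edge `e` is `1` if `|C ∩ e| = 1`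
and `0` otherwise. -/
def cutVector {V : Type*} (G : SimpleGraph V) (C : Set V) : G.edgeSet → ℤ :=
  fun e => if (C ∩ {x | x ∈ (e : Sym2 V)}).ncard = 1 then 1 else 0

/-- The index type of the columns of `A_G`: the pairwise distinct cut vectors of `G`. -/
abbrev CutVectors {V : Type*} (G : SimpleGraph V) : Type _ :=
  {δ : G.edgeSet → ℤ // δ ∈ Set.range (cutVector G)}

/-- The configuration `A_G`: its columns are the distinct cut vectors of `G`, each extended by an
entry `1` in one extra row (indexed by `Sum.inr ()`). -/
def cutMatrix {V : Type*} (G : SimpleGraph V) : Matrix (G.edgeSet ⊕ Unit) (CutVectors G) ℤ :=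
  fun i δ => Sum.elim δ.1 (fun _ => 1) i

/-- The cut ideal `I_G`. -/
def cutIdeal (K : Type*) [Field K] {V : Type*} (G : SimpleGraph V) :
    Ideal (MvPolynomial (CutVectors G) K) :=
  toricIdeal K (cutMatrix G)

/-- `B` is a Gröbner basis of `I` for the monomial order `m`: it is contained in `I`, and the
leading terms of its elements generate the initial ideal of `I`. -/
def IsGroebnerBasis {K : Type*} [Field K] {σ : Type*} (m : MonomialOrder σ)
    (I : Ideal (MvPolynomial σ K)) (B : Set (MvPolynomial σ K)) : Prop :=
  B ⊆ I ∧ Ideal.span (m.leadingTerm '' B) =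
    Ideal.span (m.leadingTerm '' (I : Set (MvPolynomial σ K)))

/-- `I` has a lexicographic quadratic Gröbner basis: for the lexicographic order that comes from
some linear ordering of the variables, `I` has a Gröbner basis consisting of quadratic forms. -/
def HasLexQuadraticGroebnerBasis {K : Type*} [Field K] {σ : Type*} [Finite σ]
    (I : Ideal (MvPolynomial σ K)) : Prop :=
  ∃ (_ : LinearOrder σ) (B : Set (MvPolynomial σ K)),
    IsGroebnerBasis (MonomialOrder.lex : MonomialOrder σ) I B ∧ ∀ g ∈ B, g.IsHomogeneous 2

/-- The graph obtained from `G` by merging the vertices `u` and `v`; loops are removed and parallel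
edges are identified. For adjacent `u`, `v` it is the contraction of the edge `uv`. -/
def contractEdge {V : Type*} (G : SimpleGraph V) (u v : V) :
    SimpleGraph (Quot fun a b : V => a = u ∧ b = v) :=
  G.map (Quot.mk fun a b : V => a = u ∧ b = v)

/-- `ContractsTo H G`: a graph isomorphic to `H` is obtained from `G` by a finite (possibly empty)
sequence of edge contractions. -/
inductive ContractsTo.{w, v} {W : Type w} (H : SimpleGraph W) :
    ∀ {V : Type v}, SimpleGraph V → Prop
  | of_iso {V : Type v} {G : SimpleGraph V} (e : G ≃g H) : ContractsTo H G
  | contract {V : Type v} {G : SimpleGraph V} {x y : V} (hxy : G.Adj x y)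
      (h : ContractsTo H (contractEdge G x y)) : ContractsTo H G

end

/-! The cuts of `G` pulled back from `K_{2,3}` are those vanishing on the contracted edges. Cut
vectors are nonnegative, so these columns form a face, and every fibre of a product of such columns
stays inside it. With one vertex of the 2-side fixed, a cut of `K_{2,3}` is a bit `b` and a triple
`t`, with entries `t i` and `t i ^^ b`. This gives two 3-cubes with a common centre, whose body
diagonals all have the same sum.

Take the lexicographically smallest body diagonal of both cubes and the largest variable of the cube
not containing it. Their product is the leading monomial of a cubic binomial (`sum_neighbours`).
None of its quadratic divisors is a leading monomial: the diagonal is smallest in its fibre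
(`exists_eq_antipodal`), and a product across the two cubes is alone in its fibre
(`single_add_single_eq_of_ne`). So no quadratic basis reaches this cubic (`not_quadratic_of_cubic`).
-/

/-! ### Toric ideals and quadratic Gröbner bases -/

open MvPolynomial in
theorem aeval_single_monomial {K : Type*} [Field K] {M n : Type*} [AddCommMonoid M] (p : n → M)
    (u : n →₀ ℕ) (c : K) :
    aeval (fun j : n => (AddMonoidAlgebra.single (p j) 1 : AddMonoidAlgebra K M)) (monomial u c) =
      AddMonoidAlgebra.single (u.sum fun j k => k • p j) c := by
  have key : ∀ u : n →₀ ℕ,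
      aeval (fun j : n => (AddMonoidAlgebra.single (p j) 1 : AddMonoidAlgebra K M))
        (monomial u (1 : K)) = AddMonoidAlgebra.single (u.sum fun j k => k • p j) 1 := by
    intro u
    induction u using Finsupp.induction_linear with
    | zero =>
      rw [monomial_zero', map_one, map_one, Finsupp.sum_zero_index, AddMonoidAlgebra.one_def]
    | add u v hu hv =>
      rw [show monomial (u + v) (1 : K) = monomial u 1 * monomial v 1 by simp [monomial_mul],
        map_mul, hu, hv, AddMonoidAlgebra.single_mul_single, mul_one,
        Finsupp.sum_add_index' (by simp) (by simp [add_smul])]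
    | single j k =>
      rw [aeval_monomial, Finsupp.prod_single_index (by simp), Finsupp.sum_single_index (by simp),
        AddMonoidAlgebra.single_pow]
      simp
  rw [← mul_one c, ← smul_eq_mul, ← smul_monomial, map_smul, key, AddMonoidAlgebra.smul_single]

theorem mem_toricIdeal_iff {K : Type*} [Field K] {d n : Type*} (A : Matrix d n ℤ)
    (g : MvPolynomial n K) :
    g ∈ toricIdeal K A ↔ ∑ u ∈ g.support, (AddMonoidAlgebra.single
      (u.sum fun j k => k • A.col j) (g.coeff u) : AddMonoidAlgebra K (d → ℤ)) = 0 := by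
  conv_lhs => rw [toricIdeal, RingHom.mem_ker, g.as_sum, map_sum]
  exact Eq.congr_left (Finset.sum_congr rfl fun u _ => aeval_single_monomial A.col u (g.coeff u))

open MvPolynomial in
theorem monomial_sub_monomial_mem_toricIdeal {K : Type*} [Field K] {d n : Type*}
    (A : Matrix d n ℤ) {u v : n →₀ ℕ}
    (h : (u.sum fun j k => k • A.col j) = v.sum fun j k => k • A.col j) :
    monomial u 1 - monomial v 1 ∈ toricIdeal K A := by
  rw [toricIdeal, RingHom.mem_ker, map_sub, sub_eq_zero]
  exact (aeval_single_monomial A.col u 1).trans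
    ((congrArg (AddMonoidAlgebra.single · 1) h).trans (aeval_single_monomial A.col v 1).symm)

open MvPolynomial in
/-- A monomial of an element of a toric ideal shares its degree with another one. -/
theorem exists_mem_support_ne_of_mem_toricIdeal {K : Type*} [Field K] {d n : Type*}
    (A : Matrix d n ℤ) {g : MvPolynomial n K} (hg : g ∈ toricIdeal K A) {u : n →₀ ℕ}
    (hu : u ∈ g.support) :
    ∃ v ∈ g.support, v ≠ u ∧
      (v.sum fun j k => k • A.col j) = u.sum fun j k => k • A.col j := by
  classical
  by_contra! hne
  rw [mem_toricIdeal_iff] at hg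
  -- If `u` were alone in its fibre, nothing could cancel its coefficient here.
  have h0 := DFunLike.congr_fun (congrArg AddMonoidAlgebra.coeff hg)
    (u.sum fun j k => k • A.col j)
  rw [AddMonoidAlgebra.coeff_sum, Finsupp.finsetSum_apply, Finset.sum_eq_single u] at h0
  · rw [AddMonoidAlgebra.coeff_single, Finsupp.single_eq_same] at h0
    exact (mem_support_iff.mp hu) h0
  · intro v hv hvu
    rw [AddMonoidAlgebra.coeff_single, Finsupp.single_eq_of_ne (hne v hv hvu).symm]
  · exact fun h => (h hu).elim

theorem Finsupp.exists_eq_single_add_single_of_degree_eq_two {σ : Type*} {u : σ →₀ ℕ}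
    (h : u.degree = 2) : ∃ j k, u = Finsupp.single j 1 + Finsupp.single k 1 := by
  classical
  have hc : Multiset.card (Finsupp.toMultiset u) = 2 := by
    rw [Finsupp.card_toMultiset]; exact h
  obtain ⟨j, k, hjk⟩ := Multiset.card_eq_two.mp hc
  refine ⟨j, k, Multiset.toFinsupp.symm.injective ?_⟩
  change Finsupp.toMultiset u = Finsupp.toMultiset _
  rw [hjk, map_add, Finsupp.toMultiset_single, Finsupp.toMultiset_single, one_smul, one_smul]
  rfl

theorem Finsupp.eq_of_degree_eq_two_of_le {σ : Type*} {u : σ →₀ ℕ} (h : u.degree = 2) {a b c : σ}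
    (hle : u ≤ Finsupp.single a 1 + Finsupp.single b 1 + Finsupp.single c 1) :
    u = Finsupp.single a 1 + Finsupp.single b 1 ∨ u = Finsupp.single a 1 + Finsupp.single c 1 ∨
      u = Finsupp.single b 1 + Finsupp.single c 1 := by
  classical
  obtain ⟨w, hw⟩ := exists_add_of_le hle
  have hdeg := congrArg Finsupp.degree hw
  have hw1 : w.degree = 1 := by
    simp only [map_add, Finsupp.degree_single, h] at hdeg
    omega
  have hc : Multiset.card (Finsupp.toMultiset w) = 1 := by
    rw [Finsupp.card_toMultiset]; exact hw1
  obtain ⟨k, hk⟩ := Multiset.card_eq_one.mp hc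
  obtain rfl : w = Finsupp.single k 1 := by
    refine Multiset.toFinsupp.symm.injective ?_
    change Finsupp.toMultiset w = Finsupp.toMultiset _
    rw [hk, Finsupp.toMultiset_single, one_smul]
  have hk' : k = a ∨ k = b ∨ k = c := by
    by_contra! hne
    have := DFunLike.congr_fun hw k
    simp [hne.1.symm, hne.2.1.symm, hne.2.2.symm] at this
  rcases hk' with rfl | rfl | rfl
  · right; right
    exact add_right_cancel (hw.symm.trans (by abel))
  · right; left
    exact add_right_cancel (hw.symm.trans (by abel))
  · left
    exact add_right_cancel hw.symm

open MvPolynomial in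
theorem IsGroebnerBasis.exists_degree_le {K : Type*} [Field K] {σ : Type*} {m : MonomialOrder σ}
    {I : Ideal (MvPolynomial σ K)} {B : Set (MvPolynomial σ K)} (hB : IsGroebnerBasis m I B)
    {f : MvPolynomial σ K} (hf : f ∈ I) (hf0 : f ≠ 0) :
    ∃ g ∈ B, g ≠ 0 ∧ m.degree g ≤ m.degree f := by
  classical
  have h1 : m.leadingTerm f ∈ Ideal.span (m.leadingTerm '' B) :=
    hB.2 ▸ Ideal.subset_span (Set.mem_image_of_mem _ hf)
  -- Zero is discarded: its degree 0 would divide every monomial.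
  have h2 : Ideal.span (m.leadingTerm '' B) ≤
      Ideal.span ((fun s => monomial s (1 : K)) '' (m.degree '' (B \ {0}))) := by
    rw [Ideal.span_le]
    rintro _ ⟨g, hg, rfl⟩
    by_cases h0 : g = 0
    · simp [h0]
    · rw [SetLike.mem_coe, ← m.C_mul_leadingCoeff_monomial_degree g]
      exact Ideal.mul_mem_left _ _ (Ideal.subset_span ⟨_, ⟨g, ⟨hg, h0⟩, rfl⟩, rfl⟩)
  obtain ⟨_, ⟨g, hg, rfl⟩, hle⟩ := mem_ideal_span_monomial_image.mp (h2 h1) (m.degree f)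
    (by rw [m.support_leadingTerm' hf0]; simp)
  exact ⟨g, hg.1, hg.2, hle⟩

open MvPolynomial MonomialOrder in
/-- A toric ideal with a cubic binomial whose initial monomial is divisible by no quadratic
initial monomial has no quadratic Gröbner basis. -/
theorem not_quadratic_of_cubic {K : Type*} [Field K] {d n : Type*} (A : Matrix d n ℤ)
    (m : MonomialOrder n) {B : Set (MvPolynomial n K)} (hB : IsGroebnerBasis m (toricIdeal K A) B)
    (hq : ∀ g ∈ B, g.IsHomogeneous 2) (a b c : n) (w : n →₀ ℕ)
    (hw : ∀ i, (w.sum fun j k => k • A.col j) i = A i a + A i b + A i c)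
    (hlt : w ≺[m] Finsupp.single a 1 + Finsupp.single b 1 + Finsupp.single c 1)
    (hab : ∀ j k, (∀ i, A i j + A i k = A i a + A i b) →
      Finsupp.single a 1 + Finsupp.single b 1 ≼[m] Finsupp.single j 1 + Finsupp.single k 1)
    (hac : ∀ j k, (∀ i, A i j + A i k = A i a + A i c) →
      Finsupp.single a 1 + Finsupp.single c 1 ≼[m] Finsupp.single j 1 + Finsupp.single k 1)
    (hbc : ∀ j k, (∀ i, A i j + A i k = A i b + A i c) →
      Finsupp.single b 1 + Finsupp.single c 1 ≼[m] Finsupp.single j 1 + Finsupp.single k 1) :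
    False := by
  classical
  have hsum : ∀ j k : n, ((Finsupp.single j 1 + Finsupp.single k 1).sum
      fun j k => k • A.col j) = fun i => A i j + A i k := by
    intro j k
    rw [Finsupp.sum_add_index' (by simp) (by simp [add_smul]), Finsupp.sum_single_index (by simp),
      Finsupp.sum_single_index (by simp)]
    ext i; simp
  set u : n →₀ ℕ := Finsupp.single a 1 + Finsupp.single b 1 + Finsupp.single c 1 with hu
  have husum : (u.sum fun j k => k • A.col j) = fun i => A i a + A i b + A i c := by
    rw [hu, Finsupp.sum_add_index' (by simp) (by simp [add_smul]), hsum,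
      Finsupp.sum_single_index (by simp)]
    ext i; simp
  have hmem : (monomial u 1 - monomial w 1 : MvPolynomial n K) ∈ toricIdeal K A :=
    monomial_sub_monomial_mem_toricIdeal A (husum.trans (funext fun i => (hw i).symm))
  have hd1 : ∀ v : n →₀ ℕ, m.degree (monomial v (1 : K)) = v := fun v => by
    rw [degree_monomial, if_neg one_ne_zero]
  have hdlt : m.degree (monomial w (1 : K)) ≺[m] m.degree (monomial u (1 : K)) := by
    rw [hd1, hd1]; exact hlt
  have hdeg : m.degree (monomial u 1 - monomial w 1 : MvPolynomial n K) = u := by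
    rw [degree_sub_of_lt hdlt, hd1]
  have hne : (monomial u 1 - monomial w 1 : MvPolynomial n K) ≠ 0 := by
    intro h
    rw [sub_eq_zero] at h
    rw [h] at hdlt
    exact lt_irrefl _ hdlt
  obtain ⟨g, hgB, hg0, hle⟩ := hB.exists_degree_le hmem hne
  rw [hdeg] at hle
  have hdeg2 : ∀ v ∈ g.support, v.degree = 2 := by
    intro v hv
    have := hq g hgB (mem_support_iff.mp hv)
    rwa [Pi.one_def, ← Finsupp.degree_eq_weight_one] at this
  have hgs := m.degree_mem_support hg0
  -- A second monomial of `g` in the fibre of the leading one is strictly smaller, against the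
  -- minimality hypotheses.
  obtain ⟨v, hv, hvne, hvs⟩ := exists_mem_support_ne_of_mem_toricIdeal A (hB.1 hgB) hgs
  have hvlt : v ≺[m] m.degree g :=
    lt_of_le_of_ne (m.le_degree hv) fun h => hvne (m.toSyn.injective h)
  obtain ⟨j, k, rfl⟩ := Finsupp.exists_eq_single_add_single_of_degree_eq_two (hdeg2 v hv)
  rw [hsum] at hvs
  rcases Finsupp.eq_of_degree_eq_two_of_le (hdeg2 _ hgs) hle with h | h | h <;>
    rw [h, hsum] at hvs <;> rw [h] at hvlt
  · exact (hab j k (congrFun hvs)).not_gt hvlt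
  · exact (hac j k (congrFun hvs)).not_gt hvlt
  · exact (hbc j k (congrFun hvs)).not_gt hvlt

/-! ### Contractions as vertex maps -/

/-- The map `f` exhibits `H` as a contraction of `G`: it maps edges to edges or points, lifts edges,
and has connected fibres. -/
structure IsContractionMap {V W : Type*} (G : SimpleGraph V) (H : SimpleGraph W) (f : V → W) :
    Prop where
  eq_or_adj : ∀ u v, G.Adj u v → f u = f v ∨ H.Adj (f u) (f v)
  lift_adj : ∀ a b, H.Adj a b → ∃ u v, G.Adj u v ∧ f u = a ∧ f v = b
  -- Connectedness phrased through vertex sets, ready to be applied to the side of a cut.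
  fibre : ∀ C : Set V, (∀ u v, G.Adj u v → f u = f v → (u ∈ C ↔ v ∈ C)) →
    ∀ u v, f u = f v → (u ∈ C ↔ v ∈ C)

theorem ContractsTo.exists_isContractionMap {W : Type*} {H : SimpleGraph W} {V : Type*}
    {G : SimpleGraph V} (h : ContractsTo H G) : ∃ f : V → W, IsContractionMap G H f := by
  induction h with
  | of_iso e =>
    refine ⟨e, fun u v huv => Or.inr (e.map_adj_iff.mpr huv), fun a b hab =>
      ⟨e.symm a, e.symm b, e.symm.map_adj_iff.mpr hab, by simp, by simp⟩, fun C _ u v huv => ?_⟩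
    rw [e.injective huv]
  | @contract V G x y hxy h ih =>
    obtain ⟨f, hf⟩ := ih
    set π : V → Quot fun a b : V => a = x ∧ b = y := Quot.mk _ with hπ
    refine ⟨f ∘ π, ?_, ?_, ?_⟩
    · intro u v huv
      by_cases hne : π u = π v
      · exact Or.inl (congrArg f hne)
      · exact hf.eq_or_adj _ _ ⟨hne, u, v, huv, rfl, rfl⟩
    · intro a b hab
      obtain ⟨_, _, ⟨-, u, v, huv, rfl, rfl⟩, h1, h2⟩ := hf.lift_adj a b hab
      exact ⟨u, v, huv, h1, h2⟩
    · intro C hC u v huv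
      -- The contracted edge lies in a fibre, so `C` descends to the quotient.
      have hxyC : x ∈ C ↔ y ∈ C := by
        refine hC x y hxy (congrArg f ?_)
        exact Quot.sound ⟨rfl, rfl⟩
      let C' : Set (Quot fun a b : V => a = x ∧ b = y) :=
        fun q => Quot.lift (fun w => w ∈ C)
          (by rintro a b ⟨rfl, rfl⟩; exact propext hxyC) q
      refine hf.fibre C' ?_ (π u) (π v) huv
      rintro _ _ ⟨-, u', v', huv', rfl, rfl⟩ he
      exact hC u' v' huv' he

/-! ### The two cubes of cuts pulled back from `K_{2,3}` -/

theorem cutVector_apply {V : Type*} (G : SimpleGraph V) (C : Set V) {u v : V} (h : G.Adj u v)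
    [Decidable (u ∈ C ↔ v ∈ C)] :
    cutVector G C ⟨s(u, v), h⟩ = if (u ∈ C ↔ v ∈ C) then 0 else 1 := by
  classical
  have hne := h.ne
  have hset : {x | x ∈ s(u, v)} = ({u, v} : Set V) := by ext; simp
  rw [cutVector]
  simp only [hset]
  by_cases hu : u ∈ C <;> by_cases hv : v ∈ C
  · rw [Set.inter_eq_right.mpr (by rintro z (rfl | rfl) <;> assumption), Set.ncard_pair hne]
    simp [hu, hv]
  · rw [show C ∩ {u, v} = {u} by ext z; simp; grind]
    simp [hu, hv]
  · rw [show C ∩ {u, v} = {v} by ext z; simp; grind]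
    simp [hu, hv]
  · rw [show C ∩ {u, v} = ∅ by ext z; simp; grind]
    simp [hu, hv]

/-- The side of the vertex `w` of `K_{2,3}` in the cut with parameters `b` and `t`. -/
def bipartiteSide (b : Bool) (t : Fin 3 → Bool) : Fin 2 ⊕ Fin 3 → Bool
  | Sum.inl 0 => false
  | Sum.inl 1 => b
  | Sum.inr i => t i

/-- The cut vector of `G` pulled back from a cut of `K_{2,3}`. -/
noncomputable def pulledCut {V : Type*} (G : SimpleGraph V) (f : V → Fin 2 ⊕ Fin 3) (b : Bool)
    (t : Fin 3 → Bool) : CutVectors G :=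
  ⟨cutVector G {v | bipartiteSide b t (f v) = true}, Set.mem_range_self _⟩

theorem pulledCut_apply {V : Type*} (G : SimpleGraph V) (f : V → Fin 2 ⊕ Fin 3) (b : Bool)
    (t : Fin 3 → Bool) {u v : V} (h : G.Adj u v) :
    (pulledCut G f b t).1 ⟨s(u, v), h⟩ =
      ((bipartiteSide b t (f u) ^^ bipartiteSide b t (f v)).toNat : ℤ) := by
  classical
  have key : ∀ (x y : Bool) [Decidable (x = true ↔ y = true)],
      (if (x = true ↔ y = true) then 0 else 1 : ℤ) = ((x ^^ y).toNat : ℤ) := by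
    intro x y _
    cases x <;> cases y <;> simp
  exact (cutVector_apply G _ h).trans (key _ _)

/-- Two columns of the cut matrix whose sum vanishes on the contracted edges are pulled back. -/
theorem exists_eq_pulledCut {V : Type*} {G : SimpleGraph V} {f : V → Fin 2 ⊕ Fin 3}
    (hf : IsContractionMap G (completeBipartiteGraph (Fin 2) (Fin 3)) f) (δ : CutVectors G)
    (h : ∀ u v (huv : G.Adj u v), f u = f v → δ.1 ⟨s(u, v), huv⟩ = 0) :
    ∃ b t, δ = pulledCut G f b t := by
  classical
  obtain ⟨_, C, rfl⟩ := δ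
  have hC := hf.fibre C fun u v huv he => by
    have := (cutVector_apply G C huv).symm.trans (h u v huv he)
    by_contra hn
    simp [hn] at this
  have hsurj : Function.Surjective f := by
    rintro (j | i)
    · obtain ⟨u, v, -, h1, -⟩ := hf.lift_adj (Sum.inl j) (Sum.inr 0) (by simp)
      exact ⟨u, h1⟩
    · obtain ⟨u, v, -, h1, -⟩ := hf.lift_adj (Sum.inr i) (Sum.inl 0) (by simp)
      exact ⟨u, h1⟩
  obtain ⟨g, hg⟩ := hsurj.hasRightInverse
  have hmem : ∀ v, v ∈ C ↔ g (f v) ∈ C := fun v => hC _ _ (hg (f v)).symm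
  -- Complementing a side keeps its cut vector, so `Sum.inl 0` may be put on the side `false`.
  let χ : Fin 2 ⊕ Fin 3 → Bool := fun w => decide (g w ∈ C) ^^ decide (g (Sum.inl 0) ∈ C)
  refine ⟨χ (Sum.inl 1), fun i => χ (Sum.inr i), Subtype.ext (funext ?_)⟩
  have hχ : bipartiteSide (χ (Sum.inl 1)) (fun i => χ (Sum.inr i)) = χ := by
    funext w
    rcases w with j | i
    · fin_cases j <;> simp [bipartiteSide, χ]
    · rfl
  rintro ⟨e, he⟩
  induction e using Sym2.ind with
  | _ u v =>
    refine (cutVector_apply G C he).trans ((pulledCut_apply G f _ _ he).trans ?_).symm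
    rw [hχ]
    simp only [hmem u, hmem v]
    by_cases h1 : g (f u) ∈ C <;> by_cases h2 : g (f v) ∈ C <;>
      by_cases h3 : g (Sum.inl 0) ∈ C <;> simp [χ, h1, h2, h3]

/-- Two columns with the same sum as two pulled back cuts are pulled back, and the entries at the
six edges of `K_{2,3}` agree. -/
theorem add_apply_pulledCut {V : Type*} {G : SimpleGraph V} {f : V → Fin 2 ⊕ Fin 3}
    (hf : IsContractionMap G (completeBipartiteGraph (Fin 2) (Fin 3)) f) {δ δ' : CutVectors G}
    {b b' : Bool} {s s' : Fin 3 → Bool}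
    (h : δ.1 + δ'.1 = (pulledCut G f b s).1 + (pulledCut G f b' s').1) :
    ∃ c t c' t', δ = pulledCut G f c t ∧ δ' = pulledCut G f c' t' ∧
      ∀ i, (t i).toNat + (t' i).toNat = (s i).toNat + (s' i).toNat ∧
        (t i ^^ c).toNat + (t' i ^^ c').toNat = (s i ^^ b).toNat + (s' i ^^ b').toNat := by
  -- The face argument: nonnegative entries with sum zero both vanish.
  have hnn : ∀ (δ : CutVectors G) e, 0 ≤ δ.1 e := by
    rintro ⟨_, C, rfl⟩ e
    simp only [cutVector]
    split_ifs <;> simp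
  have hz : ∀ u v (huv : G.Adj u v), f u = f v →
      δ.1 ⟨s(u, v), huv⟩ = 0 ∧ δ'.1 ⟨s(u, v), huv⟩ = 0 := by
    intro u v huv he
    have := congrFun h ⟨s(u, v), huv⟩
    simp only [Pi.add_apply, pulledCut_apply, he, Bool.xor_self, Bool.toNat_false] at this
    have h1 := hnn δ ⟨s(u, v), huv⟩
    have h2 := hnn δ' ⟨s(u, v), huv⟩
    omega
  obtain ⟨c, t, rfl⟩ := exists_eq_pulledCut hf δ fun u v huv he => (hz u v huv he).1
  obtain ⟨c', t', rfl⟩ := exists_eq_pulledCut hf δ' fun u v huv he => (hz u v huv he).2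
  refine ⟨c, t, c', t', rfl, rfl, fun i => ⟨?_, ?_⟩⟩
  · obtain ⟨u, v, huv, h1, h2⟩ := hf.lift_adj (Sum.inl 0) (Sum.inr i) (by simp)
    have := congrFun h ⟨s(u, v), huv⟩
    simp only [Pi.add_apply, pulledCut_apply, h1, h2, bipartiteSide, Bool.false_xor] at this
    exact_mod_cast this
  · obtain ⟨u, v, huv, h1, h2⟩ := hf.lift_adj (Sum.inl 1) (Sum.inr i) (by simp)
    have := congrFun h ⟨s(u, v), huv⟩
    simp only [Pi.add_apply, pulledCut_apply, h1, h2, bipartiteSide] at this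
    simp only [Bool.xor_comm _ c, Bool.xor_comm _ c', Bool.xor_comm _ b, Bool.xor_comm _ b']
    exact_mod_cast this

theorem pulledCut_injective {V : Type*} {G : SimpleGraph V} {f : V → Fin 2 ⊕ Fin 3}
    (hf : IsContractionMap G (completeBipartiteGraph (Fin 2) (Fin 3)) f) (b : Bool) :
    Function.Injective (pulledCut G f b) := by
  intro t t' h
  funext i
  obtain ⟨u, v, huv, h1, h2⟩ := hf.lift_adj (Sum.inl 0) (Sum.inr i) (by simp)
  have := congrFun (congrArg Subtype.val h) ⟨s(u, v), huv⟩
  simp only [pulledCut_apply, h1, h2, bipartiteSide] at this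
  revert this
  cases t i <;> cases t' i <;> simp

/-- The fibre of two columns from different cubes is a singleton. -/
theorem single_add_single_eq_of_ne {V : Type*} {G : SimpleGraph V} {f : V → Fin 2 ⊕ Fin 3}
    (hf : IsContractionMap G (completeBipartiteGraph (Fin 2) (Fin 3)) f) {δ δ' : CutVectors G}
    {b b' : Bool} {s s' : Fin 3 → Bool} (hb : b ≠ b')
    (h : δ.1 + δ'.1 = (pulledCut G f b s).1 + (pulledCut G f b' s').1) :
    Finsupp.single δ 1 + Finsupp.single δ' 1 =
      (Finsupp.single (pulledCut G f b s) 1 + Finsupp.single (pulledCut G f b' s') 1 :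
        CutVectors G →₀ ℕ) := by
  obtain ⟨c, t, c', t', rfl, rfl, hi⟩ := add_apply_pulledCut hf h
  have key : (c = b ∧ c' = b' ∧ ∀ i, t i = s i ∧ t' i = s' i) ∨
      (c = b' ∧ c' = b ∧ ∀ i, t i = s' i ∧ t' i = s i) := by
    -- The two equations at one index give `c + c' ≡ b + b'` modulo 2; as `b ≠ b'`, the bits match
    -- up to a swap. The equations then fix the sum and the difference of `t i` and `t' i`.
    have hcc : (c = b ∧ c' = b') ∨ (c = b' ∧ c' = b) := by
      have := hi 0
      generalize t 0 = x, t' 0 = y, s 0 = z, s' 0 = w at this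
      clear h hi hf
      decide +revert
    rcases hcc with ⟨rfl, rfl⟩ | ⟨rfl, rfl⟩
    · refine Or.inl ⟨rfl, rfl, fun i => ?_⟩
      have := hi i
      generalize t i = x, t' i = y, s i = z, s' i = w at this ⊢
      clear h hi hf
      decide +revert
    · refine Or.inr ⟨rfl, rfl, fun i => ?_⟩
      have := hi i
      generalize t i = x, t' i = y, s i = z, s' i = w at this ⊢
      clear h hi hf
      decide +revert
  rcases key with ⟨rfl, rfl, h'⟩ | ⟨rfl, rfl, h'⟩
  · rw [show t = s from funext fun i => (h' i).1, show t' = s' from funext fun i => (h' i).2]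
  · rw [show t = s' from funext fun i => (h' i).1, show t' = s from funext fun i => (h' i).2,
      add_comm]

/-- The fibre of a body diagonal consists of body diagonals. -/
theorem exists_eq_antipodal {V : Type*} {G : SimpleGraph V} {f : V → Fin 2 ⊕ Fin 3}
    (hf : IsContractionMap G (completeBipartiteGraph (Fin 2) (Fin 3)) f) {δ δ' : CutVectors G}
    {b : Bool} {s : Fin 3 → Bool}
    (h : δ.1 + δ'.1 = (pulledCut G f b s).1 + (pulledCut G f b fun i => !s i).1) :
    ∃ c t, δ = pulledCut G f c t ∧ δ' = pulledCut G f c fun i => !t i := by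
  obtain ⟨c, t, c', t', rfl, rfl, hi⟩ := add_apply_pulledCut hf h
  have ht : t' = fun i => !t i := by
    funext i
    have := (hi i).1
    revert this
    cases t i <;> cases t' i <;> cases s i <;> simp
  have hc : c' = c := by
    have := (hi 0).2
    simp only [ht] at this
    generalize t 0 = x, s 0 = y at this
    clear h hi ht hf
    decide +revert
  exact ⟨c, t, rfl, by rw [ht, hc]⟩

/-- A vertex of one cube and a body diagonal of the other have the same sum as the three neighbours
of the vertex. -/
theorem sum_neighbours {V : Type*} {G : SimpleGraph V} {f : V → Fin 2 ⊕ Fin 3}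
    (hf : IsContractionMap G (completeBipartiteGraph (Fin 2) (Fin 3)) f) {b : Bool}
    (s t : Fin 3 → Bool) (e : G.edgeSet) :
    ∑ k : Fin 3, (pulledCut G f (!b) (Function.update t k (!t k))).1 e =
      (pulledCut G f (!b) t).1 e + (pulledCut G f b s).1 e +
        (pulledCut G f b fun i => !s i).1 e := by
  obtain ⟨e, he⟩ := e
  induction e using Sym2.ind with
  | _ u v =>
    -- At each edge two neighbours of `t` keep its entry `x` and one flips it: `2x + (1 - x) = x +
    -- 1`, and the diagonal contributes the 1. On contracted edges everything is 0.
    have main : ∀ (j : Fin 2) (i : Fin 3), ∑ k : Fin 3,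
        ((bipartiteSide (!b) (Function.update t k (!t k)) (Sum.inl j) ^^
          bipartiteSide (!b) (Function.update t k (!t k)) (Sum.inr i)).toNat : ℤ) =
        ((bipartiteSide (!b) t (Sum.inl j) ^^ bipartiteSide (!b) t (Sum.inr i)).toNat : ℤ) +
        ((bipartiteSide b s (Sum.inl j) ^^ bipartiteSide b s (Sum.inr i)).toNat : ℤ) +
        ((bipartiteSide b (fun i => !s i) (Sum.inl j) ^^
          bipartiteSide b (fun i => !s i) (Sum.inr i)).toNat : ℤ) := by
      intro j i
      have hside : ∀ (b : Bool) (t : Fin 3 → Bool),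
          bipartiteSide b t (Sum.inl j) = (decide (j = 1) && b) := by
        intro b t
        fin_cases j <;> simp [bipartiteSide]
      have hside' : ∀ (b : Bool) (t : Fin 3 → Bool), bipartiteSide b t (Sum.inr i) = t i :=
        fun _ _ => rfl
      simp only [hside, hside', Fin.sum_univ_three, Function.update_apply]
      generalize decide (j = 1) = y
      have hcond : ∀ k, (if i = k then !t k else t i) = (decide (i = k) ^^ t i) := by
        intro k
        by_cases h : i = k <;> simp [h]
      simp only [hcond]
      generalize t i = x, s i = z
      clear hcond hside hside'
      clear he hf t s j
      decide +revert
    rw [Fintype.sum_congr _ _ fun k => pulledCut_apply G f _ _ he, pulledCut_apply G f _ _ he,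
      pulledCut_apply G f _ _ he, pulledCut_apply G f _ _ he]
    rcases hf.eq_or_adj u v he with h | h
    · simp [h]
    · generalize f u = x, f v = y at h
      rcases x with j | i <;> rcases y with j' | i'
      · simp at h
      · exact main j i'
      · simpa only [Bool.xor_comm _ (bipartiteSide _ _ (Sum.inr i))] using main j' i
      · simp at h

/-! ### The cubic obstruction for lexicographic orders -/

open MonomialOrder in
/-- A configuration containing a face that is the free sum of two 3-cubes, with vertices `X b t` for
`b : Bool`, has no lexicographic quadratic Gröbner basis. The cubic binomial that obstructs it is
the product of the largest vertex of one cube and the smallest body diagonal `X b s`, `X b (!s)` of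
both cubes, minus the product of the three neighbours of that vertex. -/
theorem not_hasLexQuadraticGroebnerBasis_of_two_cubes (K : Type*) [Field K] {d n : Type*}
    [Finite n] (A : Matrix d n ℤ) (X : Bool → (Fin 3 → Bool) → n)
    (hinj : ∀ b, Function.Injective (X b))
    (hsum : ∀ b s t i, ∑ k : Fin 3, A i (X (!b) (Function.update t k (!t k))) =
      A i (X (!b) t) + A i (X b s) + A i (X b fun i => !s i))
    (hvertices : ∀ b s t j k, (∀ i, A i j + A i k = A i (X (!b) t) + A i (X b s)) →
      Finsupp.single j 1 + Finsupp.single k 1 =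
        (Finsupp.single (X (!b) t) 1 + Finsupp.single (X b s) 1 : n →₀ ℕ))
    (hdiagonal : ∀ b s j k, (∀ i, A i j + A i k = A i (X b s) + A i (X b fun i => !s i)) →
      ∃ c r, j = X c r ∧ k = X c fun i => !r i) :
    ¬ HasLexQuadraticGroebnerBasis (toricIdeal K A) := by
  rintro ⟨_, B, hB, hq⟩
  -- The minimum runs over both cubes, since a diagonal's fibre meets both.
  obtain ⟨⟨b, s⟩, -, hmin⟩ := Finset.exists_min_image (Finset.univ : Finset (Bool × (Fin 3 → Bool)))
    (fun p => (lex : MonomialOrder n).toSyn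
      (Finsupp.single (X p.1 p.2) 1 + Finsupp.single (X p.1 fun i => !p.2 i) 1)) ⟨default, by simp⟩
  -- The least index is the largest variable for `lex`.
  obtain ⟨t, -, ht⟩ := Finset.exists_min_image (Finset.univ : Finset (Fin 3 → Bool))
    (fun t => X (!b) t) ⟨default, by simp⟩
  let N : Fin 3 → n := fun k => X (!b) (Function.update t k (!t k))
  have hN : ∀ k, X (!b) t < N k := fun k => by
    refine lt_of_le_of_ne (ht _ (Finset.mem_univ _)) fun h => ?_
    have := congrFun (hinj _ h) k
    simp at this
  refine not_quadratic_of_cubic A lex hB hq (X (!b) t) (X b s) (X b fun i => !s i)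
    (∑ k, Finsupp.single (N k) 1) ?_ ?_ ?_ ?_ ?_
  · intro i
    rw [← Finsupp.sum_finsetSum_index (by simp) (by simp [add_smul]), Finset.sum_apply,
      ← hsum b s t i]
    refine Finset.sum_congr rfl fun k _ => ?_
    rw [Finsupp.sum_single_index (by simp), one_smul]
    rfl
  · rw [lex_lt_iff, Finsupp.Lex.lt_iff]
    -- At the first variable of the cubic monomial, and before it, the product of neighbours has
    -- exponent 0.
    obtain ⟨i, hi, hle⟩ : ∃ i, (i = X (!b) t ∨ i = X b s ∨ i = X b fun i => !s i) ∧
        i ≤ X (!b) t ∧ i ≤ X b s ∧ i ≤ X b fun i => !s i := by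
      refine ⟨min (X (!b) t) (min (X b s) (X b fun i => !s i)), ?_, by simp⟩
      rcases min_choice (X (!b) t) (min (X b s) (X b fun i => !s i)) with h | h <;> rw [h]
      · exact Or.inl rfl
      · exact Or.inr (min_choice _ _)
    have hzero : ∀ j ≤ i, (∑ k, Finsupp.single (N k) 1 : n →₀ ℕ) j = 0 := by
      intro j hj
      rw [Finsupp.finsetSum_apply]
      exact Finset.sum_eq_zero fun k _ =>
        Finsupp.single_eq_of_ne ((hj.trans hle.1).trans_lt (hN k)).ne
    refine ⟨i, fun j hj => ?_, ?_⟩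
    · refine (hzero j hj.le).trans ?_
      simp [(hj.trans_le hle.1).ne, (hj.trans_le hle.2.1).ne, (hj.trans_le hle.2.2).ne]
    · refine (hzero i le_rfl).trans_lt ?_
      rcases hi with h | h | h <;> simp [← h]
  · exact fun j k h => (congrArg _ (hvertices b s t j k h)).ge
  · exact fun j k h => (congrArg _ (hvertices b (fun i => !s i) t j k h)).ge
  · intro j k h
    obtain ⟨c, r, rfl, rfl⟩ := hdiagonal b s j k h
    exact hmin (c, r) (Finset.mem_univ _)

theorem mainTheorem4 (K : Type*) [Field K] {V : Type*} [Finite V] (G : SimpleGraph V)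
    (hG : ContractsTo (completeBipartiteGraph (Fin 2) (Fin 3)) G) :
    ¬ HasLexQuadraticGroebnerBasis (cutIdeal K G) := by
  obtain ⟨f, hf⟩ := hG.exists_isContractionMap
  have hcol : ∀ {δ₁ δ₂ δ₃ δ₄ : CutVectors G},
      (∀ i, cutMatrix G i δ₁ + cutMatrix G i δ₂ = cutMatrix G i δ₃ + cutMatrix G i δ₄) →
      δ₁.1 + δ₂.1 = δ₃.1 + δ₄.1 := fun h => funext fun e => h (Sum.inl e)
  refine not_hasLexQuadraticGroebnerBasis_of_two_cubes K (cutMatrix G) (pulledCut G f)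
    (pulledCut_injective hf) ?_
    (fun b s t j k h => single_add_single_eq_of_ne hf (by simp) (hcol h))
    (fun b s j k h => exists_eq_antipodal hf (hcol h))
  rintro b s t (e | ⟨⟩)
  · exact sum_neighbours hf s t e
  · simp [cutMatrix]
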